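/- Let $\mathbb F$ be a field and let $q\in\mathbb F$ be nonzero and not a root of unity (that is, $q^n\neq 1$ for all integers $n\ge 1$). Let $\Delta=\Delta_q$ be the universal Askey–Wilson algebra: the associative unital $\mathbb F$-algebra with generators $A,B,C$ and relations asserting that each of $$A+\frac{qBC-q^{-1}CB}{q^2-q^{-2}},\qquad B+\frac{qCA-q^{-1}AC}{q^2-q^{-2}},\qquad C+\frac{qAB-q^{-1}BA}{q^2-q^{-2}}$$ is central in $\Delta$. Let $\alpha,\beta,\gamma$ denote $q+q^{-1}$ times these three elements, respectively, and let $$\Omega=qABC+q^2A^2+q^{-2}B^2+q^2C^2-qA\alpha-q^{-1}B\beta-qC\gamma .$$ Let $Z(\Delta)$ be the center of $\Delta$. Then: 1. The elements $\Omega^\ell\alpha^r\beta^s\gamma^t$ $(\ell,r,s,t\in\mathbb N=\{0,1,2,\dots\})$ form a basis of the $\mathbb F$-vector space $Z(\Delta)$. 2. $Z(\Delta)$ is generated, as an $\mathbb F$-algebra, by $\Omega,\alpha,\beta,\gamma$. 3. There is an $\mathbb F$-algebra isomorphism $Z(\Delta)\to\mathbb F[\lambda_1,\lambda_2,\lambda_3,\lambda_4]$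 onto the polynomial algebra in four commuting indeterminates that sends $\Omega\mapsto\lambda_1$, $\alpha\mapsto\lambda_2$, $\beta\mapsto\lambda_3$, $\gamma\mapsto\lambda_4$. -/

import Mathlib

namespace UAW

variable {F : Type*} [Field F]

/-- The expression `x + (q y z - q⁻¹ z y) / (q² - q⁻²)` in an `F`-algebra. -/
def centralExpr {R : Type*} [Ring R] [Algebra F R] (q : F) (x y z : R) : R :=
  x + (q ^ 2 - q⁻¹ ^ 2)⁻¹ • (q • (y * z) - q⁻¹ • (z * y))

/-- The free generators; `0, 1, 2` stand for `A, B, C`. -/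
abbrev freeGen (F : Type*) [Field F] (i : Fin 3) : FreeAlgebra F (Fin 3) :=
  FreeAlgebra.ι F i

/-- The defining relations of the universal Askey–Wilson algebra: each of
`A + (qBC - q⁻¹CB)/(q² - q⁻²)`, `B + (qCA - q⁻¹AC)/(q² - q⁻²)`, `C + (qAB - q⁻¹BA)/(q² - q⁻²)`
commutes with every element. -/
inductive Rel (q : F) : FreeAlgebra F (Fin 3) → FreeAlgebra F (Fin 3) → Prop
  | centralA (x : FreeAlgebra F (Fin 3)) :
      Rel q (centralExpr q (freeGen F 0) (freeGen F 1) (freeGen F 2) * x)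
        (x * centralExpr q (freeGen F 0) (freeGen F 1) (freeGen F 2))
  | centralB (x : FreeAlgebra F (Fin 3)) :
      Rel q (centralExpr q (freeGen F 1) (freeGen F 2) (freeGen F 0) * x)
        (x * centralExpr q (freeGen F 1) (freeGen F 2) (freeGen F 0))
  | centralC (x : FreeAlgebra F (Fin 3)) :
      Rel q (centralExpr q (freeGen F 2) (freeGen F 0) (freeGen F 1) * x)
        (x * centralExpr q (freeGen F 2) (freeGen F 0) (freeGen F 1))

/-- The universal Askey–Wilson algebra `Δ_q`, by generators and relations. -/
abbrev Delta (q : F) : Type _ := RingQuot (Rel q)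

noncomputable section

/-- The generator `A` of `Δ_q`. -/
def genA (q : F) : Delta q := RingQuot.mkAlgHom F (Rel q) (freeGen F 0)

/-- The generator `B` of `Δ_q`. -/
def genB (q : F) : Delta q := RingQuot.mkAlgHom F (Rel q) (freeGen F 1)

/-- The generator `C` of `Δ_q`. -/
def genC (q : F) : Delta q := RingQuot.mkAlgHom F (Rel q) (freeGen F 2)

/-- `α = (q + q⁻¹) (A + (qBC - q⁻¹CB)/(q² - q⁻²))`. -/
def alpha (q : F) : Delta q := (q + q⁻¹) • centralExpr q (genA q) (genB q) (genC q)

/-- `β = (q + q⁻¹) (B + (qCA - q⁻¹AC)/(q² - q⁻²))`. -/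
def beta (q : F) : Delta q := (q + q⁻¹) • centralExpr q (genB q) (genC q) (genA q)

/-- `γ = (q + q⁻¹) (C + (qAB - q⁻¹BA)/(q² - q⁻²))`. -/
def gamma (q : F) : Delta q := (q + q⁻¹) • centralExpr q (genC q) (genA q) (genB q)

/-- The Casimir element
`Ω = qABC + q²A² + q⁻²B² + q²C² - qAα - q⁻¹Bβ - qCγ`. -/
def Omega (q : F) : Delta q :=
  q • (genA q * genB q * genC q) + q ^ 2 • genA q ^ 2 + q⁻¹ ^ 2 • genB q ^ 2
    + q ^ 2 • genC q ^ 2 - q • (genA q * alpha q) - q⁻¹ • (genB q * beta q)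
    - q • (genC q * gamma q)

end

end UAW

/-!
The center is computed by comparing leading terms, as in a quantum affine space.

Over the polynomial ring `R = F[α, β, γ]` the defining relations rewrite `BA`, `CA` and `CB` as
multiples of `AB`, `AC` and `BC` plus terms of lower degree, when `A`, `B`, `C` have degree one and
`α`, `β`, `γ` have degree zero. The ordered monomials `AⁱBʲCᵏ` are an `R`-basis of `Δ_q`. To see
this, operators `A`, `B`, `C` are defined on the free `R`-module on the triples `(i, j, k)` by
recursion, as the left multiplications that the rewriting rules dictate; they satisfy the relations
because the only overlap, `CBA`, is resolvable (`AWDatum.opC_opB_opA`). So `Δ_q` acts on this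
module. Applying an element to the monomial `1` gives a map `toPBW` which is inverse to the map
`ofPBW` from formal to actual ordered monomials, since `ofPBW` intertwines the two actions (`ofPBW_action`,
`toPBW_ofPBW`).

Up to lower degree, `AⁱBʲCᵏ·A = q^(2j-2k) Aⁱ⁺¹BʲCᵏ`, `B·AⁱBʲCᵏ = q^(2i) AⁱBʲ⁺¹Cᵏ` and
`AⁱBʲCᵏ·B = q^(2k) AⁱBʲ⁺¹Cᵏ`. As `q` is not a root of unity, the top part of a central element can
involve only the monomials with `i = j = k` (`diagonal_of_mem_center`). The Casimir element is
central and `Ωˡ` has leading term `q^(l²) AˡBˡCˡ`, a unit times the diagonal monomial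
(`AWDatum.opOmega_pow_leading`). Hence subtracting `R`-multiples of powers of `Ω` reduces every
central element to zero (`exists_casimirHom_eq`), and the powers of `Ω` are independent over `R`
(`casimirHom_injective`). So the center is the polynomial ring `R[Ω]`, and `R` is itself a
polynomial ring in `α`, `β`, `γ`; the statements on bases and generators follow.
-/

namespace UAW

/-! ### The Poincaré–Birkhoff–Witt module -/

/-- Parameters for the Askey–Wilson relations over a commutative ring `R`: an invertible `q`, with
inverse `qi`, and the scalars `a`, `b`, `c` by which `α`, `β`, `γ` are to act. -/
structure AWDatum (R : Type*) [CommRing R] where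
  /-- the deformation parameter -/
  q : R
  /-- the inverse of `q` -/
  qi : R
  /-- the value of `α` -/
  a : R
  /-- the value of `β` -/
  b : R
  /-- the value of `γ` -/
  c : R
  mul_qi : q * qi = 1

/-- The free `R`-module on the exponents `(i, j, k)` of the ordered monomials `AⁱBʲCᵏ`. -/
abbrev PBWModule (R : Type*) [CommRing R] : Type _ := (ℕ × ℕ × ℕ) →₀ R

noncomputable section

variable {R : Type*} [CommRing R]

/-- The basis vector that stands for the ordered monomial `AⁱBʲCᵏ`. -/
def mono (i j k : ℕ) : PBWModule R := Finsupp.single (i, j, k) 1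

lemma linearCombination_mono {M : Type*} [AddCommGroup M] [Module R M] (f : ℕ × ℕ × ℕ → M)
    (i j k : ℕ) : Finsupp.linearCombination R f (mono i j k) = f (i, j, k) := by
  simp [mono]

lemma pbw_hom_ext {M : Type*} [AddCommGroup M] [Module R M] {f g : PBWModule R →ₗ[R] M}
    (h : ∀ i j k, f (mono i j k) = g (mono i j k)) : f = g := by
  refine Finsupp.lhom_ext' fun p => LinearMap.ext_ring ?_
  exact h p.1 p.2.1 p.2.2

/-- A linear map sends the span of a set of monomials into a submodule as soon as it does so on
these monomials. -/
lemma map_mem_of_supported {M : Type*} [AddCommGroup M] [Module R M] {f : PBWModule R →ₗ[R] M}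
    {s : Set (ℕ × ℕ × ℕ)} {N : Submodule R M}
    (h : ∀ i j k, (i, j, k) ∈ s → f (mono i j k) ∈ N) {m : PBWModule R}
    (hm : m ∈ Finsupp.supported R R s) : f m ∈ N := by
  rw [Finsupp.supported_eq_span_single] at hm
  have : Submodule.span R ((fun i => Finsupp.single i (1 : R)) '' s) ≤ N.comap f := by
    rw [Submodule.span_le]
    rintro _ ⟨p, hp, rfl⟩
    exact h p.1 p.2.1 p.2.2 hp
  exact this hm

/-- Two linear maps agree on the span of a set of monomials as soon as they agree on these
monomials. -/
lemma eq_of_supported {M : Type*} [AddCommGroup M] [Module R M] {f g : PBWModule R →ₗ[R] M}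
    {s : Set (ℕ × ℕ × ℕ)} (h : ∀ i j k, (i, j, k) ∈ s → f (mono i j k) = g (mono i j k))
    {m : PBWModule R} (hm : m ∈ Finsupp.supported R R s) : f m = g m := by
  have := map_mem_of_supported (f := f - g) (N := ⊥) (s := s)
    (fun i j k hp => by simp [h i j k hp]) hm
  simpa [sub_eq_zero] using this

/-- Multiplication by `A` on the left. -/
def opA : PBWModule R →ₗ[R] PBWModule R :=
  Finsupp.linearCombination R fun p => mono (p.1 + 1) p.2.1 p.2.2

@[simp] lemma opA_mono (i j k : ℕ) : opA (mono i j k : PBWModule R) = mono (i + 1) j k :=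
  linearCombination_mono _ i j k

/-- The span of the monomials whose exponent of `B` is at most `n`. -/
def filB (R : Type*) [CommRing R] (n : ℕ) : Submodule R (PBWModule R) :=
  Finsupp.supported R R {p | p.2.1 ≤ n}

/-- The span of the monomials of total degree less than `n`. -/
def filD (R : Type*) [CommRing R] (n : ℕ) : Submodule R (PBWModule R) :=
  Finsupp.supported R R {p | p.1 + p.2.1 + p.2.2 < n}

lemma mono_mem_filB {i j k n : ℕ} (h : j ≤ n) : mono i j k ∈ filB R n :=
  Finsupp.single_mem_supported R _ h

lemma mono_mem_filD {i j k n : ℕ} (h : i + j + k < n) : mono i j k ∈ filD R n :=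
  Finsupp.single_mem_supported R _ h

lemma filB_mono {m n : ℕ} (h : m ≤ n) : filB R m ≤ filB R n :=
  Finsupp.supported_mono fun _ hp => le_trans hp h

lemma filD_mono {m n : ℕ} (h : m ≤ n) : filD R m ≤ filD R n :=
  Finsupp.supported_mono fun _ hp => lt_of_lt_of_le hp h

lemma opA_mem_filB {n : ℕ} {m : PBWModule R} (hm : m ∈ filB R n) : opA m ∈ filB R n :=
  map_mem_of_supported (fun i j k h => by rw [opA_mono]; exact mono_mem_filB h) hm

lemma opA_mem_filD {n : ℕ} {m : PBWModule R} (hm : m ∈ filD R n) : opA m ∈ filD R (n + 1) :=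
  map_mem_of_supported (fun i j k h => by
    rw [opA_mono]
    have h' : i + j + k < n := h
    exact mono_mem_filD (by lia)) hm

namespace AWDatum

variable (P : AWDatum R)

/-- The pair `(B·AⁱBʲCᵏ, C·AⁱBʲCᵏ)`, computed by moving `B` and `C` across the powers of `A`, when
the products `C·BʲCᵏ` are prescribed as `f j k`. -/
def bcRec (f : ℕ → ℕ → PBWModule R) : ℕ → ℕ → ℕ → PBWModule R × PBWModule R
  | 0, j, k => (mono 0 (j + 1) k, f j k)
  | i + 1, j, k =>
    (P.q ^ 2 • opA (bcRec f i j k).1 - ((P.q ^ 2 - 1) * P.c) • mono i j k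
        + (P.q ^ 3 - P.qi) • (bcRec f i j k).2,
      P.qi ^ 2 • opA (bcRec f i j k).2 + ((1 - P.qi ^ 2) * P.b) • mono i j k
        - (P.q - P.qi ^ 3) • (bcRec f i j k).1)

/-- The operator `B` when the products `C·BʲCᵏ` are prescribed as `f j k`. -/
def preB (f : ℕ → ℕ → PBWModule R) : PBWModule R →ₗ[R] PBWModule R :=
  Finsupp.linearCombination R fun p => (P.bcRec f p.1 p.2.1 p.2.2).1

/-- Approximations to the products `C·BʲCᵏ`: the `n`-th one is correct for `j ≤ n`. -/
def stage : ℕ → ℕ → ℕ → PBWModule R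
  | 0 => fun _ k => mono 0 0 (k + 1)
  | n + 1 => fun j k =>
    if j ≤ n then stage n j k
    else P.q ^ 2 • P.preB (stage n) (stage n n k) - ((P.q ^ 2 - 1) * P.a) • mono 0 n k
      + (P.q ^ 3 - P.qi) • mono 1 n k

/-- The product `C·BʲCᵏ` written in ordered monomials. -/
def cB (j k : ℕ) : PBWModule R := P.stage j j k

/-- Multiplication by `B` on the left. -/
def opB : PBWModule R →ₗ[R] PBWModule R := P.preB P.cB

/-- Multiplication by `C` on the left. -/
def opC : PBWModule R →ₗ[R] PBWModule R :=
  Finsupp.linearCombination R fun p => (P.bcRec P.cB p.1 p.2.1 p.2.2).2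

lemma preB_mono (f : ℕ → ℕ → PBWModule R) (i j k : ℕ) :
    P.preB f (mono i j k) = (P.bcRec f i j k).1 :=
  linearCombination_mono _ i j k

lemma opC_mono (i j k : ℕ) : P.opC (mono i j k) = (P.bcRec P.cB i j k).2 :=
  linearCombination_mono _ i j k

lemma stage_eq_cB {n j : ℕ} (h : j ≤ n) : P.stage n j = P.cB j := by
  induction n with
  | zero => obtain rfl : j = 0 := by lia
            rfl
  | succ n ih =>
    rcases h.lt_or_eq with h' | rfl
    · funext k
      rw [← ih (by lia)]
      exact if_pos (by lia)
    · rfl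

lemma bcRec_congr {f g : ℕ → ℕ → PBWModule R} {j : ℕ} (h : f j = g j) (i k : ℕ) :
    P.bcRec f i j k = P.bcRec g i j k := by
  induction i with
  | zero => simp [bcRec, h]
  | succ i ih => simp [bcRec, ih]

lemma bcRec_mem_filB {f : ℕ → ℕ → PBWModule R} {j k : ℕ} (h : f j k ∈ filB R (j + 1)) (i : ℕ) :
    (P.bcRec f i j k).1 ∈ filB R (j + 1) ∧ (P.bcRec f i j k).2 ∈ filB R (j + 1) := by
  induction i with
  | zero => exact ⟨mono_mem_filB le_rfl, h⟩
  | succ i ih =>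
    have h0 : mono i j k ∈ filB R (j + 1) := mono_mem_filB (by lia)
    exact ⟨add_mem (sub_mem (Submodule.smul_mem _ _ (opA_mem_filB ih.1))
        (Submodule.smul_mem _ _ h0)) (Submodule.smul_mem _ _ ih.2),
      sub_mem (add_mem (Submodule.smul_mem _ _ (opA_mem_filB ih.2))
        (Submodule.smul_mem _ _ h0)) (Submodule.smul_mem _ _ ih.1)⟩

lemma cB_succ_stage (j k : ℕ) : P.cB (j + 1) k =
    P.q ^ 2 • P.preB (P.stage j) (P.cB j k) - ((P.q ^ 2 - 1) * P.a) • mono 0 j k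
      + (P.q ^ 3 - P.qi) • mono 1 j k := by
  rw [← stage_eq_cB P (le_refl j)]
  exact if_neg (by lia)

/-- Writing `C·BʲCᵏ` in ordered monomials does not raise the exponent of `B`; this is what makes the
approximations `stage` stabilize. -/
lemma cB_mem_filB (j k : ℕ) : P.cB j k ∈ filB R j := by
  induction j using Nat.strong_induction_on generalizing k with
  | _ j ih =>
    cases j with
    | zero => exact mono_mem_filB le_rfl
    | succ j =>
      rw [cB_succ_stage]
      refine add_mem (sub_mem (Submodule.smul_mem _ _ ?_) (Submodule.smul_mem _ _
        (mono_mem_filB (by lia)))) (Submodule.smul_mem _ _ (mono_mem_filB (by lia)))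
      refine map_mem_of_supported (fun i' j' k' h => ?_) (ih j (by lia) k)
      have h' : j' ≤ j := h
      rw [preB_mono]
      refine filB_mono (by lia) (P.bcRec_mem_filB ?_ i').1
      rw [stage_eq_cB P h']
      exact filB_mono (by lia) (ih j' (by lia) k')

/-- The defining recursion for `C·BʲCᵏ`, free of approximations. -/
lemma cB_succ (j k : ℕ) : P.cB (j + 1) k =
    P.q ^ 2 • P.opB (P.cB j k) - ((P.q ^ 2 - 1) * P.a) • mono 0 j k
      + (P.q ^ 3 - P.qi) • mono 1 j k := by
  rw [cB_succ_stage, eq_of_supported (f := P.preB (P.stage j)) (g := P.opB) _ (P.cB_mem_filB j k)]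
  intro i' j' k' h
  rw [opB, preB_mono, preB_mono, P.bcRec_congr (P.stage_eq_cB h)]

@[simp] lemma opB_mono_zero (j k : ℕ) : P.opB (mono 0 j k) = mono 0 (j + 1) k := by
  rw [opB, preB_mono, bcRec]

@[simp] lemma opC_mono_zero (j k : ℕ) : P.opC (mono 0 j k) = P.cB j k := by
  rw [opC_mono, bcRec]

lemma opB_mono_succ (i j k : ℕ) : P.opB (mono (i + 1) j k) =
    P.q ^ 2 • opA (P.opB (mono i j k)) - ((P.q ^ 2 - 1) * P.c) • mono i j k
      + (P.q ^ 3 - P.qi) • P.opC (mono i j k) := by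
  rw [opC_mono, opB, preB_mono, preB_mono, bcRec]

lemma opC_mono_succ (i j k : ℕ) : P.opC (mono (i + 1) j k) =
    P.qi ^ 2 • opA (P.opC (mono i j k)) + ((1 - P.qi ^ 2) * P.b) • mono i j k
      - (P.q - P.qi ^ 3) • P.opB (mono i j k) := by
  rw [opC_mono, opC_mono, opB, preB_mono, bcRec]

/-! ### The Askey–Wilson relations on the module -/

lemma opB_opA (m : PBWModule R) : P.opB (opA m) =
    P.q ^ 2 • opA (P.opB m) - ((P.q ^ 2 - 1) * P.c) • m + (P.q ^ 3 - P.qi) • P.opC m := by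
  have : P.opB ∘ₗ opA = P.q ^ 2 • (opA ∘ₗ P.opB) - ((P.q ^ 2 - 1) * P.c) • LinearMap.id
      + (P.q ^ 3 - P.qi) • P.opC :=
    pbw_hom_ext fun i j k => by simp [opB_mono_succ]
  exact LinearMap.congr_fun this m

lemma opC_opA (m : PBWModule R) : P.opC (opA m) =
    P.qi ^ 2 • opA (P.opC m) + ((1 - P.qi ^ 2) * P.b) • m - (P.q - P.qi ^ 3) • P.opB m := by
  have : P.opC ∘ₗ opA = P.qi ^ 2 • (opA ∘ₗ P.opC) + ((1 - P.qi ^ 2) * P.b) • LinearMap.id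
      - (P.q - P.qi ^ 3) • P.opB :=
    pbw_hom_ext fun i j k => by simp [opC_mono_succ]
  exact LinearMap.congr_fun this m

/-- The overlap `CBA` is resolvable: if the relation between `C` and `B` holds at `m`, then it
holds at `A m`, because of the other two relations. -/
lemma opC_opB_opA {m : PBWModule R} (h : P.opC (P.opB m) =
      P.q ^ 2 • P.opB (P.opC m) - ((P.q ^ 2 - 1) * P.a) • m + (P.q ^ 3 - P.qi) • opA m) :
    P.opC (P.opB (opA m)) = P.q ^ 2 • P.opB (P.opC (opA m)) - ((P.q ^ 2 - 1) * P.a) • opA m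
      + (P.q ^ 3 - P.qi) • opA (opA m) := by
  have hq := P.mul_qi
  have e1 : P.qi ^ 2 * P.q ^ 2 = 1 := by linear_combination (P.q * P.qi + 1) * hq
  rw [opC_opA, opB_opA]
  simp only [map_add, map_sub, map_smul, opC_opA, opB_opA, h]
  match_scalars
  · ring
  · linear_combination (-(P.q ^ 2 - 1) * P.a) * e1
  · linear_combination (P.q ^ 3 - P.qi) * e1
  · ring
  · ring
  · linear_combination ((P.q ^ 2 - 1) * P.c) * e1
  · linear_combination (-(P.q ^ 3 - P.qi)) * e1

lemma opC_opB (m : PBWModule R) : P.opC (P.opB m) =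
    P.q ^ 2 • P.opB (P.opC m) - ((P.q ^ 2 - 1) * P.a) • m + (P.q ^ 3 - P.qi) • opA m := by
  have : P.opC ∘ₗ P.opB = P.q ^ 2 • (P.opB ∘ₗ P.opC) - ((P.q ^ 2 - 1) * P.a) • LinearMap.id
      + (P.q ^ 3 - P.qi) • opA := by
    refine pbw_hom_ext fun i j k => ?_
    induction i with
    | zero => simp only [LinearMap.comp_apply, LinearMap.add_apply, LinearMap.sub_apply,
        LinearMap.smul_apply, LinearMap.id_apply, opB_mono_zero, opC_mono_zero, cB_succ, opA_mono]
    | succ i ih =>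
      rw [← opA_mono]
      exact P.opC_opB_opA ih
  exact LinearMap.congr_fun this m

/-! ### Leading terms -/

/-- The leading terms of `B·AⁱBʲCᵏ` and `C·AⁱBʲCᵏ`, for all monomials of degree `n` at once: the
recursion for `C·BʲCᵏ` needs `B` on all monomials of smaller degree, and the recursion in `i` needs
both products for the previous `i`. -/
lemma leading_aux (n : ℕ) : ∀ i j k : ℕ, i + j + k = n →
    P.opB (mono i j k) - P.q ^ (2 * i) • mono i (j + 1) k ∈ filD R (n + 1) ∧
    P.opC (mono i j k) - (P.qi ^ (2 * i) * P.q ^ (2 * j)) • mono i j (k + 1) ∈ filD R (n + 1) := by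
  induction n using Nat.strong_induction_on with
  | _ n ih =>
    intro i j k hn
    rcases i with _ | i
    · refine ⟨by simp, ?_⟩
      rcases j with _ | j
      · simp [cB, stage]
      · have hC := (ih (j + k) (by lia) 0 j k (by lia)).2
        have hB : P.opB (P.cB j k - P.q ^ (2 * j) • mono 0 j (k + 1)) ∈ filD R (n + 1) := by
          simp only [opC_mono_zero, mul_zero, pow_zero, one_mul] at hC
          refine map_mem_of_supported (fun i' j' k' h => ?_) hC
          have h' : i' + j' + k' < j + k + 1 := h
          have := (ih (i' + j' + k') (by lia) i' j' k' rfl).1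
          have := add_mem (filD_mono (show _ ≤ n + 1 by lia) this)
            (Submodule.smul_mem _ (P.q ^ (2 * i'))
              (mono_mem_filD (i := i') (j := j' + 1) (k := k') (n := n + 1) (R := R) (by lia)))
          simpa using this
        have e1 : mono 0 j k ∈ filD R (n + 1) := mono_mem_filD (by lia)
        have e2 : mono 1 j k ∈ filD R (n + 1) := mono_mem_filD (by lia)
        have := add_mem (sub_mem (Submodule.smul_mem _ (P.q ^ 2) hB)
          (Submodule.smul_mem _ ((P.q ^ 2 - 1) * P.a) e1))
          (Submodule.smul_mem _ (P.q ^ 3 - P.qi) e2)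
        convert this using 1
        simp only [opC_mono_zero, cB_succ, map_sub, map_smul, opB_mono_zero]
        module
    · obtain ⟨hB, hC⟩ := ih (i + j + k) (by lia) i j k rfl
      have hB1 := opA_mem_filD hB
      have hC1 := opA_mem_filD hC
      have e0 : mono i j k ∈ filD R (n + 1) := mono_mem_filD (by lia)
      have eB : mono i (j + 1) k ∈ filD R (n + 1) := mono_mem_filD (by lia)
      have eC : mono i j (k + 1) ∈ filD R (n + 1) := mono_mem_filD (by lia)
      obtain rfl : n = i + j + k + 1 := by lia
      replace hB := filD_mono (Nat.le_succ _) hB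
      replace hC := filD_mono (Nat.le_succ _) hC
      constructor
      · have := add_mem (add_mem (sub_mem (Submodule.smul_mem _ (P.q ^ 2) hB1)
          (Submodule.smul_mem _ ((P.q ^ 2 - 1) * P.c) e0))
          (Submodule.smul_mem _ (P.q ^ 3 - P.qi) hC))
          (Submodule.smul_mem _ ((P.q ^ 3 - P.qi) * (P.qi ^ (2 * i) * P.q ^ (2 * j))) eC)
        convert this using 1
        simp only [opB_mono_succ, map_sub, map_smul, opA_mono]
        module
      · have := sub_mem (sub_mem (add_mem (Submodule.smul_mem _ (P.qi ^ 2) hC1)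
          (Submodule.smul_mem _ ((1 - P.qi ^ 2) * P.b) e0))
          (Submodule.smul_mem _ (P.q - P.qi ^ 3) hB))
          (Submodule.smul_mem _ ((P.q - P.qi ^ 3) * P.q ^ (2 * i)) eB)
        convert this using 1
        simp only [opC_mono_succ, map_sub, map_smul, opA_mono]
        module

lemma opB_leading (i j k : ℕ) :
    P.opB (mono i j k) - P.q ^ (2 * i) • mono i (j + 1) k ∈ filD R (i + j + k + 1) :=
  (P.leading_aux _ i j k rfl).1

lemma opC_leading (i j k : ℕ) :
    P.opC (mono i j k) - (P.qi ^ (2 * i) * P.q ^ (2 * j)) • mono i j (k + 1)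
      ∈ filD R (i + j + k + 1) :=
  (P.leading_aux _ i j k rfl).2

lemma opB_mem_filD {n : ℕ} {m : PBWModule R} (hm : m ∈ filD R n) : P.opB m ∈ filD R (n + 1) := by
  refine map_mem_of_supported (fun i j k h => ?_) hm
  have h' : i + j + k < n := h
  rw [← sub_add_cancel (P.opB (mono i j k)) (P.q ^ (2 * i) • mono i (j + 1) k)]
  exact add_mem (filD_mono (by lia) (P.opB_leading i j k))
    (Submodule.smul_mem _ _ (mono_mem_filD (by lia)))

lemma opC_mem_filD {n : ℕ} {m : PBWModule R} (hm : m ∈ filD R n) : P.opC m ∈ filD R (n + 1) := by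
  refine map_mem_of_supported (fun i j k h => ?_) hm
  have h' : i + j + k < n := h
  rw [← sub_add_cancel (P.opC (mono i j k))
    ((P.qi ^ (2 * i) * P.q ^ (2 * j)) • mono i j (k + 1))]
  exact add_mem (filD_mono (by lia) (P.opC_leading i j k))
    (Submodule.smul_mem _ _ (mono_mem_filD (by lia)))

end AWDatum

end

end UAW

namespace UAW

noncomputable section

open MvPolynomial

variable {F : Type*} [Field F] (q : F)

/-! ### The algebra `Δ_q` over the polynomial ring in `α`, `β`, `γ` -/

/-- An element of `Δ_q` that commutes with the images of all words is central. -/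
lemma mem_center_of_forall_mk {z : Delta q}
    (h : ∀ x, z * RingQuot.mkAlgHom F (Rel q) x = RingQuot.mkAlgHom F (Rel q) x * z) :
    z ∈ Subalgebra.center F (Delta q) := by
  rw [Subalgebra.mem_center_iff]
  intro y
  obtain ⟨x, rfl⟩ := RingQuot.mkAlgHom_surjective F (Rel q) y
  exact (h x).symm

lemma mk_centralExpr (x y z : FreeAlgebra F (Fin 3)) :
    RingQuot.mkAlgHom F (Rel q) (centralExpr q x y z) =
      centralExpr q (RingQuot.mkAlgHom F (Rel q) x) (RingQuot.mkAlgHom F (Rel q) y)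
        (RingQuot.mkAlgHom F (Rel q) z) := by
  simp [centralExpr]

lemma alpha_mem_center : alpha q ∈ Subalgebra.center F (Delta q) := by
  refine Subalgebra.smul_mem _ (mem_center_of_forall_mk q fun x => ?_) _
  rw [genA, genB, genC, ← mk_centralExpr, ← map_mul, ← map_mul]
  exact RingQuot.mkAlgHom_rel F (Rel.centralA x)

lemma beta_mem_center : beta q ∈ Subalgebra.center F (Delta q) := by
  refine Subalgebra.smul_mem _ (mem_center_of_forall_mk q fun x => ?_) _
  rw [genA, genB, genC, ← mk_centralExpr, ← map_mul, ← map_mul]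
  exact RingQuot.mkAlgHom_rel F (Rel.centralB x)

lemma gamma_mem_center : gamma q ∈ Subalgebra.center F (Delta q) := by
  refine Subalgebra.smul_mem _ (mem_center_of_forall_mk q fun x => ?_) _
  rw [genA, genB, genC, ← mk_centralExpr, ← map_mul, ← map_mul]
  exact RingQuot.mkAlgHom_rel F (Rel.centralC x)

@[elab_as_elim]
lemma delta_induction {p : Delta q → Prop} (algebraMap : ∀ r, p (algebraMap F (Delta q) r))
    (genA : p (genA q)) (genB : p (genB q)) (genC : p (genC q))
    (mul : ∀ x y, p x → p y → p (x * y)) (add : ∀ x y, p x → p y → p (x + y)) (x : Delta q) :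
    p x := by
  obtain ⟨y, rfl⟩ := RingQuot.mkAlgHom_surjective F (Rel q) x
  induction y using FreeAlgebra.induction with
  | grade0 r => rw [AlgHom.commutes]; exact algebraMap r
  | grade1 i =>
    fin_cases i
    · exact genA
    · exact genB
    · exact genC
  | mul a b ha hb => rw [map_mul]; exact mul _ _ ha hb
  | add a b ha hb => rw [map_add]; exact add _ _ ha hb

/-- The polynomial ring in three variables, which stand for `α`, `β`, `γ`. -/
abbrev Param (F : Type*) [Field F] : Type _ := MvPolynomial (Fin 3) F

/-- The homomorphism from the polynomial ring in three variables to the center of `Δ_q` that sends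
the variables to `α`, `β`, `γ`. -/
def paramHom : Param F →ₐ[F] Subalgebra.center F (Delta q) :=
  aeval ![⟨alpha q, alpha_mem_center q⟩, ⟨beta q, beta_mem_center q⟩, ⟨gamma q, gamma_mem_center q⟩]

/-- `Δ_q` as an algebra over the polynomial ring in three variables, which act as `α`, `β`, `γ`. -/
instance paramAlgebra : Algebra (Param F) (Delta q) :=
  ((Subalgebra.center F (Delta q)).val.comp (paramHom q)).toRingHom.toAlgebra' fun r x =>
    ((Subalgebra.mem_center_iff.1 (paramHom q r).2 x)).symm

lemma param_smul_def (r : Param F) (x : Delta q) : r • x = paramHom q r * x := rfl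

instance : IsScalarTower F (Param F) (Delta q) :=
  ⟨fun x r y => by simp [param_smul_def]⟩

lemma C_smul {M : Type*} [AddCommGroup M] [Module F M] [Module (Param F) M]
    [IsScalarTower F (Param F) M] (x : F) (y : M) :
    (C x : Param F) • y = x • y :=
  algebraMap_smul (Param F) x y

/-- The case `M = Δ_q` of `C_smul`, for rewriting: the scalar action of `F` on a `RingQuot` is not
syntactically the one that comes from its module structure. -/
lemma C_smul_delta (x : F) (y : Delta q) : (C x : Param F) • y = x • y := C_smul x y

lemma X_smul_zero (x : Delta q) : (X 0 : Param F) • x = alpha q * x := by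
  simp [param_smul_def, paramHom]

lemma X_smul_one (x : Delta q) : (X 1 : Param F) • x = beta q * x := by
  simp [param_smul_def, paramHom]

lemma X_smul_two (x : Delta q) : (X 2 : Param F) • x = gamma q * x := by
  simp [param_smul_def, paramHom]

/-- The parameters for which the Poincaré–Birkhoff–Witt module is a model of `Δ_q`. -/
@[simps] def datum {q : F} (hq0 : q ≠ 0) : AWDatum (Param F) where
  q := C q
  qi := C q⁻¹
  a := X 0
  b := X 1
  c := X 2
  mul_qi := by rw [← C_mul, mul_inv_cancel₀ hq0, C_1]

/-- In an algebra over the polynomial ring, an Askey–Wilson relation `z y = q² y z - …` solved for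
the word `z y` is equivalent to prescribing the central element. -/
lemma smul_centralExpr_eq_iff {q : F} (hq0 : q ≠ 0) (hd : q ^ 2 - q⁻¹ ^ 2 ≠ 0) {D : Type*} [Ring D]
    [Algebra F D] [Algebra (Param F) D] [IsScalarTower F (Param F) D]
    (x y z : D) (a : Param F) :
    (q + q⁻¹) • centralExpr q x y z = a • 1 ↔
      z * y = (C q ^ 2 : Param F) • (y * z) - ((C q ^ 2 - 1) * a : Param F) • (1 : D)
        + (C q ^ 3 - C q⁻¹ : Param F) • x := by
  have h1 : (C q * C q⁻¹ : Param F) = 1 := (datum hq0).mul_qi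
  have h2 : (C (q ^ 2 - q⁻¹ ^ 2)⁻¹ * (C q ^ 2 - C q⁻¹ ^ 2) : Param F) = 1 := by
    rw [← C_pow, ← C_pow, ← C_sub, ← C_mul, inv_mul_cancel₀ hd, C_1]
  rw [centralExpr, ← C_smul (q + q⁻¹), ← C_smul (q ^ 2 - q⁻¹ ^ 2)⁻¹, ← C_smul q, ← C_smul q⁻¹,
    C_add]
  generalize (C (q ^ 2 - q⁻¹ ^ 2)⁻¹ : Param F) = d at *
  generalize (C q : Param F) = Q at *
  generalize (C q⁻¹ : Param F) = Q' at *
  constructor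
  · intro h
    have h' : (Q ^ 2 - 1) • (Q + Q') • (x + d • (Q • (y * z) - Q' • (z * y)))
        = ((Q ^ 2 - 1) * a) • (1 : D) := by rw [h, mul_smul]
    rw [← h']
    match_scalars <;> grind
  · intro h
    rw [h]
    match_scalars <;> grind

/-- The other way to solve an Askey–Wilson relation, for the word `y z`. -/
lemma smul_centralExpr_eq_iff' {q : F} (hq0 : q ≠ 0) (hd : q ^ 2 - q⁻¹ ^ 2 ≠ 0) {D : Type*}
    [Ring D] [Algebra F D] [Algebra (Param F) D]
    [IsScalarTower F (Param F) D] (x y z : D) (a : Param F) :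
    (q + q⁻¹) • centralExpr q x y z = a • 1 ↔
      y * z = (C q⁻¹ ^ 2 : Param F) • (z * y) + ((1 - C q⁻¹ ^ 2) * a : Param F) • (1 : D)
        - (C q - C q⁻¹ ^ 3 : Param F) • x := by
  have h1 : (C q * C q⁻¹ : Param F) = 1 := (datum hq0).mul_qi
  rw [smul_centralExpr_eq_iff hq0 hd]
  generalize (C q : Param F) = Q at *
  generalize (C q⁻¹ : Param F) = Q' at *
  constructor
  · intro h
    rw [h]
    match_scalars <;> grind
  · intro h
    rw [h]
    match_scalars <;> grind

section Relations

variable {q} (hq0 : q ≠ 0) (hd : q ^ 2 - q⁻¹ ^ 2 ≠ 0)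
include hq0 hd

lemma genB_mul_genA : genB q * genA q =
    (C q ^ 2 : Param F) • (genA q * genB q) - ((C q ^ 2 - 1) * X 2 : Param F) • 1
      + (C q ^ 3 - C q⁻¹ : Param F) • genC q :=
  (smul_centralExpr_eq_iff hq0 hd _ _ _ _).1 (by rw [X_smul_two, mul_one]; rfl)

lemma genC_mul_genA : genC q * genA q =
    (C q⁻¹ ^ 2 : Param F) • (genA q * genC q) + ((1 - C q⁻¹ ^ 2) * X 1 : Param F) • 1
      - (C q - C q⁻¹ ^ 3 : Param F) • genB q :=
  (smul_centralExpr_eq_iff' hq0 hd _ _ _ _).1 (by rw [X_smul_one, mul_one]; rfl)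

lemma genC_mul_genB : genC q * genB q =
    (C q ^ 2 : Param F) • (genB q * genC q) - ((C q ^ 2 - 1) * X 0 : Param F) • 1
      + (C q ^ 3 - C q⁻¹ : Param F) • genA q :=
  (smul_centralExpr_eq_iff hq0 hd _ _ _ _).1 (by rw [X_smul_zero, mul_one]; rfl)

end Relations

lemma Omega_eq : Omega q = (C q : Param F) • (genA q * (genB q * genC q))
    + (C q ^ 2 : Param F) • (genA q * genA q)
    + (C q⁻¹ ^ 2 : Param F) • (genB q * genB q)
    + (C q ^ 2 : Param F) • (genC q * genC q)
    - (C q * X 0 : Param F) • genA q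
    - (C q⁻¹ * X 1 : Param F) • genB q
    - (C q * X 2 : Param F) • genC q := by
  simp only [Omega, mul_smul, X_smul_zero, X_smul_one, X_smul_two, C_smul_delta,
    Subalgebra.mem_center_iff.1 (alpha_mem_center q),
    Subalgebra.mem_center_iff.1 (beta_mem_center q),
    Subalgebra.mem_center_iff.1 (gamma_mem_center q), pow_two, mul_assoc]

/-! ### Centrality of the Casimir element -/

section Casimir

variable {R D : Type*} [CommRing R] [Ring D] [Algebra R D]

/-- The Casimir expression commutes with `A`: both products have the same expansion in ordered
monomials. -/
lemma casimir_mul_left {Q Q' a b c : R} (hQ : Q * Q' = 1) {A B C : D}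
    (hBA : B * A = Q ^ 2 • (A * B) - ((Q ^ 2 - 1) * c) • 1 + (Q ^ 3 - Q') • C)
    (hCA : C * A = Q' ^ 2 • (A * C) + ((1 - Q' ^ 2) * b) • 1 - (Q - Q' ^ 3) • B)
    (hCB : C * B = Q ^ 2 • (B * C) - ((Q ^ 2 - 1) * a) • 1 + (Q ^ 3 - Q') • A) (Z : D)
    (hZ : Z = Q • (A * (B * C)) + Q ^ 2 • (A * A) + Q' ^ 2 • (B * B) + Q ^ 2 • (C * C)
      - (Q * a) • A - (Q' * b) • B - (Q * c) • C) : Z * A = A * Z := by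
  have hBA' (x : D) := congrArg (· * x) hBA
  have hCA' (x : D) := congrArg (· * x) hCA
  simp only [mul_assoc, add_mul, sub_mul, smul_mul_assoc, one_mul] at hBA' hCA'
  rw [hZ]
  simp only [mul_add, add_mul, mul_sub, sub_mul, smul_mul_assoc, mul_smul_comm, mul_assoc,
    hBA, hCA, hCB, hBA', hCA', smul_add, smul_sub, mul_one, one_mul]
  match_scalars <;> grind

lemma casimir_mul_middle {Q Q' a b c : R} (hQ : Q * Q' = 1) {A B C : D}
    (hBA : B * A = Q ^ 2 • (A * B) - ((Q ^ 2 - 1) * c) • 1 + (Q ^ 3 - Q') • C)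
    (hCA : C * A = Q' ^ 2 • (A * C) + ((1 - Q' ^ 2) * b) • 1 - (Q - Q' ^ 3) • B)
    (hCB : C * B = Q ^ 2 • (B * C) - ((Q ^ 2 - 1) * a) • 1 + (Q ^ 3 - Q') • A) (Z : D)
    (hZ : Z = Q • (A * (B * C)) + Q ^ 2 • (A * A) + Q' ^ 2 • (B * B) + Q ^ 2 • (C * C)
      - (Q * a) • A - (Q' * b) • B - (Q * c) • C) : Z * B = B * Z := by
  have hBA' (x : D) := congrArg (· * x) hBA
  have hCB' (x : D) := congrArg (· * x) hCB
  simp only [mul_assoc, add_mul, sub_mul, smul_mul_assoc, one_mul] at hBA' hCB'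
  rw [hZ]
  simp only [mul_add, add_mul, mul_sub, sub_mul, smul_mul_assoc, mul_smul_comm, mul_assoc,
    hBA, hCA, hCB, hBA', hCB', smul_add, smul_sub, mul_one, one_mul]
  match_scalars <;> grind

lemma casimir_mul_right {Q Q' a b c : R} (hQ : Q * Q' = 1) {A B C : D}
    (hBA : B * A = Q ^ 2 • (A * B) - ((Q ^ 2 - 1) * c) • 1 + (Q ^ 3 - Q') • C)
    (hCA : C * A = Q' ^ 2 • (A * C) + ((1 - Q' ^ 2) * b) • 1 - (Q - Q' ^ 3) • B)
    (hCB : C * B = Q ^ 2 • (B * C) - ((Q ^ 2 - 1) * a) • 1 + (Q ^ 3 - Q') • A) (Z : D)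
    (hZ : Z = Q • (A * (B * C)) + Q ^ 2 • (A * A) + Q' ^ 2 • (B * B) + Q ^ 2 • (C * C)
      - (Q * a) • A - (Q' * b) • B - (Q * c) • C) : Z * C = C * Z := by
  have hCA' (x : D) := congrArg (· * x) hCA
  have hCB' (x : D) := congrArg (· * x) hCB
  simp only [mul_assoc, add_mul, sub_mul, smul_mul_assoc, one_mul] at hCA' hCB'
  rw [hZ]
  simp only [mul_add, add_mul, mul_sub, sub_mul, smul_mul_assoc, mul_smul_comm, mul_assoc,
    hBA, hCA, hCB, hCA', hCB', smul_add, smul_sub, mul_one, one_mul]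
  match_scalars <;> grind

end Casimir

lemma Omega_mem_center {q : F} (hq0 : q ≠ 0) (hd : q ^ 2 - q⁻¹ ^ 2 ≠ 0) :
    Omega q ∈ Subalgebra.center F (Delta q) := by
  have h1 : (C q * C q⁻¹ : Param F) = 1 := (datum hq0).mul_qi
  have hBA := genB_mul_genA hq0 hd
  have hCA := genC_mul_genA hq0 hd
  have hCB := genC_mul_genB hq0 hd
  rw [Subalgebra.mem_center_iff]
  intro x
  induction x using delta_induction with
  | algebraMap r => exact Algebra.commutes r _
  | genA => exact (casimir_mul_left h1 hBA hCA hCB _ (Omega_eq q)).symm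
  | genB => exact (casimir_mul_middle h1 hBA hCA hCB _ (Omega_eq q)).symm
  | genC => exact (casimir_mul_right h1 hBA hCA hCB _ (Omega_eq q)).symm
  | mul x y hx hy => rw [mul_assoc, hy, ← mul_assoc, hx, mul_assoc]
  | add x y hx hy => rw [add_mul, hx, hy, mul_add]

/-! ### Action on the module and ordered monomial basis -/

/-- The map that evaluates formal ordered monomials in `Δ_q`. -/
def ofPBW : PBWModule (Param F) →ₗ[Param F] Delta q :=
  Finsupp.linearCombination _ fun p => genA q ^ p.1 * genB q ^ p.2.1 * genC q ^ p.2.2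

@[simp] lemma ofPBW_mono (i j k : ℕ) :
    ofPBW q (mono i j k) = genA q ^ i * genB q ^ j * genC q ^ k :=
  linearCombination_mono _ i j k

lemma ofPBW_opA (m : PBWModule (Param F)) :
    ofPBW q (opA m) = genA q * ofPBW q m := by
  have : ofPBW q ∘ₗ opA = LinearMap.mulLeft (Param F) (genA q) ∘ₗ ofPBW q :=
    pbw_hom_ext fun i j k => by simp [pow_succ', mul_assoc]
  exact LinearMap.congr_fun this m

section Model

variable {q} (hq0 : q ≠ 0) (hd : q ^ 2 - q⁻¹ ^ 2 ≠ 0)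
include hd

/-- `ofPBW` intertwines `B` and `C` on monomials. The outer induction is on the exponent of `B`,
because `C·Bʲ⁺¹Cᵏ` is defined by applying `B` to `C·BʲCᵏ`, whose monomials have exponent of `B` at
most `j`; the inner one is on the exponent of `A`. -/
lemma ofPBW_mono_aux (j : ℕ) : ∀ i k,
    ofPBW q ((datum hq0).opB (mono i j k)) = genB q * ofPBW q (mono i j k) ∧
    ofPBW q ((datum hq0).opC (mono i j k)) = genC q * ofPBW q (mono i j k) := by
  induction j using Nat.strong_induction_on with
  | _ j ih =>
    intro i k
    induction i with
    | zero =>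
      refine ⟨by simp [pow_succ', mul_assoc], ?_⟩
      cases j with
      | zero => simp [AWDatum.cB, AWDatum.stage, pow_succ']
      | succ j =>
        have hB : ofPBW q ((datum hq0).opB ((datum hq0).cB j k)) =
            genB q * ofPBW q ((datum hq0).cB j k) :=
          eq_of_supported (f := ofPBW q ∘ₗ (datum hq0).opB)
            (g := LinearMap.mulLeft (Param F) (genB q) ∘ₗ ofPBW q)
            (fun i' j' k' h => (ih j' (Nat.lt_succ_of_le h) i' k').1)
            ((datum hq0).cB_mem_filB j k)
        have hC := (ih j (by lia) 0 k).2
        rw [AWDatum.opC_mono_zero] at hC ⊢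
        rw [AWDatum.cB_succ, map_add, map_sub, map_smul, map_smul, map_smul, hB, hC]
        simp only [ofPBW_mono, datum_q, datum_qi, datum_a, pow_zero, one_mul, pow_one]
        rw [pow_succ' (genB q), mul_assoc (genB q), ← mul_assoc (genC q) (genB q),
          genC_mul_genB hq0 hd]
        simp only [mul_assoc, add_mul, sub_mul, smul_mul_assoc, one_mul]
    | succ i hi =>
      have hm : (mono (i + 1) j k : PBWModule (Param F)) = opA (mono i j k) :=
        (opA_mono i j k).symm
      rw [hm, AWDatum.opB_opA, AWDatum.opC_opA, ofPBW_opA, ← mul_assoc, ← mul_assoc,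
        genB_mul_genA hq0 hd, genC_mul_genA hq0 hd]
      simp only [map_add, map_sub, map_smul, ofPBW_opA, hi.1, hi.2, datum_q, datum_qi, datum_b,
        datum_c, mul_assoc, add_mul, sub_mul, smul_mul_assoc, one_mul, and_self]

lemma ofPBW_opB (m : PBWModule (Param F)) :
    ofPBW q ((datum hq0).opB m) = genB q * ofPBW q m := by
  have : ofPBW q ∘ₗ (datum hq0).opB =
      LinearMap.mulLeft (Param F) (genB q) ∘ₗ ofPBW q :=
    pbw_hom_ext fun i j k => (ofPBW_mono_aux hq0 hd j i k).1
  exact LinearMap.congr_fun this m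

lemma ofPBW_opC (m : PBWModule (Param F)) :
    ofPBW q ((datum hq0).opC m) = genC q * ofPBW q m := by
  have : ofPBW q ∘ₗ (datum hq0).opC =
      LinearMap.mulLeft (Param F) (genC q) ∘ₗ ofPBW q :=
    pbw_hom_ext fun i j k => (ofPBW_mono_aux hq0 hd j i k).2
  exact LinearMap.congr_fun this m

lemma smul_centralExpr_opA :
    (q + q⁻¹) • centralExpr q (opA : Module.End (Param F) (PBWModule (Param F)))
      (datum hq0).opB (datum hq0).opC = (X 0 : Param F) • 1 :=
  (smul_centralExpr_eq_iff hq0 hd _ _ _ _).2 <| LinearMap.ext fun m => (datum hq0).opC_opB m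

lemma smul_centralExpr_opB :
    (q + q⁻¹) • centralExpr q ((datum hq0).opB : Module.End (Param F) (PBWModule (Param F)))
      (datum hq0).opC opA = (X 1 : Param F) • 1 :=
  (smul_centralExpr_eq_iff' hq0 hd _ _ _ _).2 <| LinearMap.ext fun m => (datum hq0).opC_opA m

lemma smul_centralExpr_opC :
    (q + q⁻¹) • centralExpr q ((datum hq0).opC : Module.End (Param F) (PBWModule (Param F)))
      opA (datum hq0).opB = (X 2 : Param F) • 1 :=
  (smul_centralExpr_eq_iff hq0 hd _ _ _ _).2 <| LinearMap.ext fun m => (datum hq0).opB_opA m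

/-- The action of `Δ_q` on the Poincaré–Birkhoff–Witt module. -/
def action : Delta q →ₐ[F]
    Module.End (Param F) (PBWModule (Param F)) :=
  RingQuot.liftAlgHom F ⟨FreeAlgebra.lift F ![opA, (datum hq0).opB, (datum hq0).opC], by
    have hs : q + q⁻¹ ≠ 0 := fun h => hd (by linear_combination (q - q⁻¹) * h)
    -- The factor `q + q⁻¹` in `α`, `β`, `γ` is cancelled, since `Rel` does not include it.
    have key : ∀ {x : Module.End (Param F) (PBWModule (Param F))}
        {a : Param F}, (q + q⁻¹) • x = a • 1 → ∀ y, x * y = y * x := by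
      intro x a h y
      have : (q + q⁻¹) • (x * y) = (q + q⁻¹) • (y * x) := by
        rw [← smul_mul_assoc, ← mul_smul_comm, h, smul_mul_assoc, mul_smul_comm, one_mul, mul_one]
      exact smul_right_injective _ hs this
    have hl : ∀ i j k, FreeAlgebra.lift F ![opA, (datum hq0).opB, (datum hq0).opC]
        (centralExpr q (freeGen F i) (freeGen F j) (freeGen F k)) =
        centralExpr q (![opA, (datum hq0).opB, (datum hq0).opC] i)
          (![opA, (datum hq0).opB, (datum hq0).opC] j)
          (![opA, (datum hq0).opB, (datum hq0).opC] k) := by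
      intro i j k
      simp [centralExpr]
    rintro _ _ (x | x | x)
    · rw [map_mul, map_mul, hl]
      exact key (smul_centralExpr_opA hq0 hd) _
    · rw [map_mul, map_mul, hl]
      exact key (smul_centralExpr_opB hq0 hd) _
    · rw [map_mul, map_mul, hl]
      exact key (smul_centralExpr_opC hq0 hd) _⟩

@[simp] lemma action_genA : action hq0 hd (genA q) = opA := by
  simp [action, genA]

@[simp] lemma action_genB : action hq0 hd (genB q) = (datum hq0).opB := by
  simp [action, genB]

@[simp] lemma action_genC : action hq0 hd (genC q) = (datum hq0).opC := by
  simp [action, genC]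

lemma ofPBW_action (x : Delta q) (m : PBWModule (Param F)) :
    ofPBW q (action hq0 hd x m) = x * ofPBW q m := by
  induction x using delta_induction generalizing m with
  | algebraMap r =>
    rw [AlgHom.commutes, Module.algebraMap_end_apply, ← C_smul r m, map_smul, C_smul_delta,
      Algebra.smul_def]
  | genA => rw [action_genA, ofPBW_opA]
  | genB => rw [action_genB, ofPBW_opB hq0 hd]
  | genC => rw [action_genC, ofPBW_opC hq0 hd]
  | mul x y hx hy => rw [map_mul, Module.End.mul_apply, hx, hy, mul_assoc]
  | add x y hx hy => rw [map_add, LinearMap.add_apply, map_add, hx, hy, add_mul]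

lemma action_centralExpr (x y z : Delta q) :
    action hq0 hd ((q + q⁻¹) • centralExpr q x y z) = (q + q⁻¹) •
      centralExpr q (action hq0 hd x) (action hq0 hd y) (action hq0 hd z) := by
  simp only [centralExpr, map_smul, map_add, map_sub, map_mul]

lemma action_alpha : action hq0 hd (alpha q) = (X 0 : Param F) • 1 := by
  rw [alpha, action_centralExpr, action_genA, action_genB, action_genC, smul_centralExpr_opA hq0 hd]

lemma action_beta : action hq0 hd (beta q) = (X 1 : Param F) • 1 := by
  rw [beta, action_centralExpr, action_genA, action_genB, action_genC, smul_centralExpr_opB hq0 hd]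

lemma action_gamma : action hq0 hd (gamma q) = (X 2 : Param F) • 1 := by
  rw [gamma, action_centralExpr, action_genA, action_genB, action_genC, smul_centralExpr_opC hq0 hd]

lemma action_paramHom (r : Param F) :
    action hq0 hd (paramHom q r) = algebraMap (Param F) _ r := by
  have : ((action hq0 hd).comp (Subalgebra.center F (Delta q)).val).comp (paramHom q) =
      IsScalarTower.toAlgHom F (Param F) (Module.End (Param F) (PBWModule (Param F))) := by
    refine MvPolynomial.algHom_ext fun i => ?_
    fin_cases i
    · simp [paramHom, action_alpha, Algebra.algebraMap_eq_smul_one]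
    · simp [paramHom, action_beta, Algebra.algebraMap_eq_smul_one]
    · simp [paramHom, action_gamma, Algebra.algebraMap_eq_smul_one]
  exact AlgHom.congr_fun this r

/-- The expansion of an element of `Δ_q` in ordered monomials, obtained by acting on the monomial
`1`. -/
def toPBW : Delta q →ₗ[Param F] PBWModule (Param F) where
  toFun x := action hq0 hd x (mono 0 0 0)
  map_add' x y := by rw [map_add, LinearMap.add_apply]
  map_smul' r x := by
    rw [param_smul_def, map_mul, action_paramHom, Module.End.mul_apply,
      Module.algebraMap_end_apply, RingHom.id_apply]

lemma toPBW_apply (x : Delta q) : toPBW hq0 hd x = action hq0 hd x (mono 0 0 0) := rfl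

lemma toPBW_mul (x y : Delta q) : toPBW hq0 hd (x * y) = action hq0 hd x (toPBW hq0 hd y) := by
  rw [toPBW_apply, map_mul, Module.End.mul_apply, toPBW_apply]

@[simp] lemma ofPBW_toPBW (x : Delta q) : ofPBW q (toPBW hq0 hd x) = x := by
  rw [toPBW_apply, ofPBW_action]
  simp

end Model

end

end UAW

namespace UAW

noncomputable section

/-! ### Leading terms of products -/

section Leading

variable {R : Type*} [CommRing R]

lemma mem_filD_of_coeff_eq_zero {n : ℕ} {m : PBWModule R} (hm : m ∈ filD R (n + 1))
    (h : ∀ i j k, i + j + k = n → m (i, j, k) = 0) : m ∈ filD R n := by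
  rw [filD, Finsupp.mem_supported'] at hm ⊢
  rintro ⟨i, j, k⟩ hp
  by_cases hn : i + j + k = n
  · exact h i j k hn
  · exact hm _ (by simp only [Set.mem_ofPred_eq] at hp ⊢; lia)

lemma coeff_eq_zero_of_mem_filD {n : ℕ} {m : PBWModule R} (hm : m ∈ filD R n) {i j k : ℕ}
    (h : n ≤ i + j + k) : m (i, j, k) = 0 := by
  rw [filD, Finsupp.mem_supported'] at hm
  exact hm _ (by simpa using h)

lemma opA_pow_mono (n i j k : ℕ) : (opA ^ n : Module.End R (PBWModule R)) (mono i j k)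
    = mono (i + n) j k := by
  induction n with
  | zero => simp
  | succ n ih => rw [pow_succ', Module.End.mul_apply, ih, opA_mono, add_assoc]

lemma opA_pow_mem_filD {n : ℕ} {m : PBWModule R} (hm : m ∈ filD R n) (l : ℕ) :
    (opA ^ l : Module.End R (PBWModule R)) m ∈ filD R (n + l) := by
  induction l with
  | zero => simpa using hm
  | succ l ih =>
    rw [pow_succ', Module.End.mul_apply]
    exact opA_mem_filD ih

/-- If `T` multiplies leading monomials by `AᵃBᵇCᶜ` with `a + b + c = 1`, up to scalars `f`, then
it does so with the top coefficients of every element. -/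
lemma coeff_of_leading {T : PBWModule R →ₗ[R] PBWModule R} {f : ℕ → ℕ → ℕ → R} {a b c : ℕ}
    (habc : a + b + c = 1)
    (hT : ∀ i j k, T (mono i j k) - f i j k • mono (i + a) (j + b) (k + c)
      ∈ filD R (i + j + k + 1))
    {n : ℕ} {m : PBWModule R} (hm : m ∈ filD R (n + 1)) {i j k : ℕ} (hn : i + j + k = n) :
    T m (i + a, j + b, k + c) = f i j k * m (i, j, k) := by
  have hsum : m = m.sum fun p r => r • mono p.1 p.2.1 p.2.2 := by
    conv_lhs => rw [← m.sum_single]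
    exact Finsupp.sum_congr fun p _ => by simp [mono]
  have key : ∀ p ∈ m.support, T (mono p.1 p.2.1 p.2.2) (i + a, j + b, k + c) =
      f p.1 p.2.1 p.2.2 * (mono p.1 p.2.1 p.2.2 : PBWModule R) (i, j, k) := by
    rintro ⟨i', j', k'⟩ hp
    have hp' : i' + j' + k' < n + 1 := (Finsupp.mem_supported R m).1 hm hp
    have := coeff_eq_zero_of_mem_filD (hT i' j' k') (i := i + a) (j := j + b) (k := k + c) (by lia)
    rw [Finsupp.sub_apply, sub_eq_zero] at this
    rw [this, Finsupp.smul_apply, smul_eq_mul, mono, mono, Finsupp.single_apply,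
      Finsupp.single_apply]
    simp
  have hT' : T m = m.sum fun p r => r • T (mono p.1 p.2.1 p.2.2) := by
    conv_lhs => rw [hsum]
    simp [Finsupp.sum, map_sum]
  rw [hT', Finsupp.sum, Finsupp.finsetSum_apply, Finset.sum_eq_single (i, j, k)]
  · by_cases h0 : (i, j, k) ∈ m.support
    · rw [Finsupp.smul_apply, key _ h0]
      simp [mono, mul_comm]
    · simp [Finsupp.notMem_support_iff.1 h0]
  · intro p hp hne
    rw [Finsupp.smul_apply, key p hp]
    simp [mono, hne]
  · intro h0
    simp [Finsupp.notMem_support_iff.1 h0]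

namespace AWDatum

variable (P : AWDatum R)

lemma q_pow_mul_qi_pow (n : ℕ) : P.q ^ n * P.qi ^ n = 1 := by
  rw [← mul_pow, P.mul_qi, one_pow]

lemma opB_pow_mono_zero (n j k : ℕ) :
    (P.opB ^ n : Module.End R (PBWModule R)) (mono 0 j k) = mono 0 (j + n) k := by
  induction n with
  | zero => simp
  | succ n ih => rw [pow_succ', Module.End.mul_apply, ih, opB_mono_zero, add_assoc]

lemma opC_pow_mono_zero (n k : ℕ) :
    (P.opC ^ n : Module.End R (PBWModule R)) (mono 0 0 k) = mono 0 0 (k + n) := by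
  induction n with
  | zero => simp
  | succ n ih =>
    rw [pow_succ', Module.End.mul_apply, ih, opC_mono_zero]
    rfl

lemma opB_pow_mem_filD {n : ℕ} {m : PBWModule R} (hm : m ∈ filD R n) (l : ℕ) :
    (P.opB ^ l : Module.End R (PBWModule R)) m ∈ filD R (n + l) := by
  induction l with
  | zero => simpa using hm
  | succ l ih =>
    rw [pow_succ', Module.End.mul_apply]
    exact P.opB_mem_filD ih

lemma opB_pow_leading (n i j k : ℕ) : (P.opB ^ n : Module.End R (PBWModule R)) (mono i j k)
    - P.q ^ (2 * i * n) • mono i (j + n) k ∈ filD R (i + j + k + n) := by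
  induction n with
  | zero => simp
  | succ n ih =>
    have h1 := P.opB_mem_filD ih
    have h2 := Submodule.smul_mem _ (P.q ^ (2 * i * n)) (P.opB_leading i (j + n) k)
    rw [show i + (j + n) + k + 1 = i + j + k + n + 1 by lia] at h2
    show _ ∈ filD R (i + j + k + n + 1)
    convert add_mem h1 h2 using 1
    rw [pow_succ', Module.End.mul_apply, map_sub, map_smul, smul_sub, smul_smul, ← pow_add,
      sub_add_sub_cancel]
    rfl

lemma opC_pow_leading (n i j k : ℕ) : (P.opC ^ n : Module.End R (PBWModule R)) (mono i j k)
    - (P.qi ^ (2 * i * n) * P.q ^ (2 * j * n)) • mono i j (k + n) ∈ filD R (i + j + k + n) := by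
  induction n with
  | zero => simp
  | succ n ih =>
    have h1 := P.opC_mem_filD ih
    have h2 := Submodule.smul_mem _ (P.qi ^ (2 * i * n) * P.q ^ (2 * j * n))
      (P.opC_leading i j (k + n))
    rw [show i + j + (k + n) + 1 = i + j + k + n + 1 by lia] at h2
    show _ ∈ filD R (i + j + k + n + 1)
    convert add_mem h1 h2 using 1
    rw [pow_succ', Module.End.mul_apply, map_sub, map_smul, smul_sub, smul_smul,
      mul_mul_mul_comm, ← pow_add, ← pow_add, sub_add_sub_cancel]
    rfl

/-- The leading term of `AⁱBʲCᵏ·A`. -/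
lemma mul_A_leading (i j k : ℕ) :
    (opA ^ i * P.opB ^ j * P.opC ^ k : Module.End R (PBWModule R)) (mono 1 0 0)
      - (P.q ^ (2 * j) * P.qi ^ (2 * k)) • mono (i + 1) (j + 0) (k + 0)
        ∈ filD R (i + j + k + 1) := by
  have h1 := opA_pow_mem_filD (P.opB_pow_mem_filD (P.opC_pow_leading k 1 0 0) j) i
  have h2 := Submodule.smul_mem _ (P.qi ^ (2 * k))
    (opA_pow_mem_filD (P.opB_pow_leading j 1 0 k) i)
  rw [show 1 + 0 + 0 + k + j + i = i + j + k + 1 by lia] at h1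
  rw [show 1 + 0 + k + j + i = i + j + k + 1 by lia] at h2
  convert add_mem h1 h2 using 1
  simp only [Module.End.mul_apply, map_sub, map_smul, opA_pow_mono, mul_one, mul_zero, zero_mul,
    pow_zero, zero_add, add_zero, smul_sub, smul_smul, one_mul,
    sub_add_sub_cancel, add_comm 1 i, mul_comm (P.qi ^ _)]

/-- The leading term of `AⁱBʲCᵏ·B`. -/
lemma mul_B_leading (i j k : ℕ) :
    (opA ^ i * P.opB ^ j * P.opC ^ k : Module.End R (PBWModule R)) (mono 0 1 0)
      - P.q ^ (2 * k) • mono (i + 0) (j + 1) (k + 0) ∈ filD R (i + j + k + 1) := by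
  have h1 := opA_pow_mem_filD (P.opB_pow_mem_filD (P.opC_pow_leading k 0 1 0) j) i
  rw [show 0 + 1 + 0 + k + j + i = i + j + k + 1 by lia] at h1
  convert h1 using 1
  simp only [Module.End.mul_apply, map_sub, map_smul, opA_pow_mono, mul_one, mul_zero, zero_mul,
    pow_zero, zero_add, add_zero, opB_pow_mono_zero, one_mul, add_comm 1 j]

/-- The Casimir element as an operator. -/
def opOmega : Module.End R (PBWModule R) :=
  P.q • (opA * (P.opB * P.opC)) + P.q ^ 2 • (opA * opA) + P.qi ^ 2 • (P.opB * P.opB)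
    + P.q ^ 2 • (P.opC * P.opC) - (P.q * P.a) • opA - (P.qi * P.b) • P.opB - (P.q * P.c) • P.opC

/-- Up to lower degree, `Ω` is `q ABC`: the other terms have degree at most two, as `α`, `β`, `γ`
are scalars. -/
lemma opOmega_sub_mem_filD {n : ℕ} {m : PBWModule R} (hm : m ∈ filD R n) :
    P.opOmega m - P.q • opA (P.opB (P.opC m)) ∈ filD R (n + 2) := by
  have hA := opA_mem_filD hm
  have hB := P.opB_mem_filD hm
  have hC := P.opC_mem_filD hm
  have hA' := filD_mono (Nat.le_succ _) hA
  have hB' := filD_mono (Nat.le_succ _) hB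
  have hC' := filD_mono (Nat.le_succ _) hC
  have := sub_mem (sub_mem (sub_mem (add_mem (add_mem
    (Submodule.smul_mem _ (P.q ^ 2) (opA_mem_filD hA))
    (Submodule.smul_mem _ (P.qi ^ 2) (P.opB_mem_filD hB)))
    (Submodule.smul_mem _ (P.q ^ 2) (P.opC_mem_filD hC)))
    (Submodule.smul_mem _ (P.q * P.a) hA'))
    (Submodule.smul_mem _ (P.qi * P.b) hB'))
    (Submodule.smul_mem _ (P.q * P.c) hC')
  convert this using 1
  simp only [opOmega, LinearMap.add_apply, LinearMap.sub_apply, LinearMap.smul_apply,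
    Module.End.mul_apply]
  abel

lemma opOmega_mem_filD {n : ℕ} {m : PBWModule R} (hm : m ∈ filD R n) :
    P.opOmega m ∈ filD R (n + 3) := by
  have h := filD_mono (Nat.le_succ _) (P.opOmega_sub_mem_filD hm)
  have h' := Submodule.smul_mem _ P.q (opA_mem_filD (P.opB_mem_filD (P.opC_mem_filD hm)))
  simpa using add_mem h h'

lemma opOmega_leading (l : ℕ) : P.opOmega (mono l l l)
    - P.q ^ (2 * l + 1) • mono (l + 1) (l + 1) (l + 1) ∈ filD R (3 * l + 3) := by
  have h0 : (mono l l l : PBWModule R) ∈ filD R (3 * l + 1) := mono_mem_filD (by lia)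
  have hC := P.opC_leading l l l
  have hB := P.opB_leading l l (l + 1)
  rw [mul_comm, q_pow_mul_qi_pow, one_smul, show l + l + l + 1 = 3 * l + 1 by lia] at hC
  rw [show l + l + (l + 1) + 1 = 3 * l + 2 by lia] at hB
  have h1 := P.opOmega_sub_mem_filD h0
  have h2 := Submodule.smul_mem _ P.q (opA_mem_filD (P.opB_mem_filD hC))
  have h3 := Submodule.smul_mem _ P.q (opA_mem_filD hB)
  convert add_mem (add_mem h1 h2) h3 using 1
  simp only [map_sub, map_smul, opA_mono, pow_succ]
  module

lemma opOmega_pow_leading (l : ℕ) :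
    (P.opOmega ^ l) (mono 0 0 0) - P.q ^ (l ^ 2) • mono l l l ∈ filD R (3 * l) := by
  induction l with
  | zero => simp
  | succ l ih =>
    have h1 := P.opOmega_mem_filD ih
    have h2 := Submodule.smul_mem _ (P.q ^ (l ^ 2)) (P.opOmega_leading l)
    show _ ∈ filD R (3 * l + 3)
    convert add_mem h1 h2 using 1
    rw [pow_succ', Module.End.mul_apply, map_sub, map_smul, smul_sub, smul_smul, ← pow_add,
      sub_add_sub_cancel, show l ^ 2 + (2 * l + 1) = (l + 1) ^ 2 by ring]

end AWDatum

end Leading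

/-! ### The center -/

section Center

open MvPolynomial

variable {F : Type*} [Field F] {q : F} (hq0 : q ≠ 0) (hd : q ^ 2 - q⁻¹ ^ 2 ≠ 0)

lemma action_Omega : action hq0 hd (Omega q) = (datum hq0).opOmega := by
  have hs (r : Param F) (x : Delta q) : action hq0 hd (r • x) = r • action hq0 hd x := by
    rw [param_smul_def, map_mul, action_paramHom, ← Algebra.smul_def]
  simp only [Omega_eq, map_add, map_sub, hs, map_mul, action_genA, action_genB, action_genC]
  rfl

lemma toPBW_Omega_pow (l : ℕ) :
    toPBW hq0 hd (Omega q ^ l) - (C q ^ (l ^ 2) : Param F) • mono l l l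
      ∈ filD (Param F) (3 * l) := by
  rw [toPBW_apply, map_pow, action_Omega]
  exact (datum hq0).opOmega_pow_leading l

@[simp] lemma toPBW_ofPBW (m : PBWModule (Param F)) : toPBW hq0 hd (ofPBW q m) = m := by
  have : toPBW hq0 hd ∘ₗ ofPBW q = LinearMap.id := by
    refine pbw_hom_ext fun i j k => ?_
    simp only [LinearMap.comp_apply, ofPBW_mono, toPBW_apply, map_mul, map_pow, action_genA,
      action_genB, action_genC, Module.End.mul_apply, AWDatum.opC_pow_mono_zero,
      AWDatum.opB_pow_mono_zero, opA_pow_mono, zero_add, LinearMap.id_apply]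
  exact LinearMap.congr_fun this m

/-- Right multiplication by `y`, in terms of ordered monomials. -/
def mulRightPBW (y : Delta q) : PBWModule (Param F) →ₗ[Param F] PBWModule (Param F) :=
  toPBW hq0 hd ∘ₗ LinearMap.mulRight (Param F) y ∘ₗ ofPBW q

lemma mulRightPBW_mono (y : Delta q) (i j k : ℕ) : mulRightPBW hq0 hd y (mono i j k) =
    (opA ^ i * (datum hq0).opB ^ j * (datum hq0).opC ^ k :
      Module.End (Param F) (PBWModule (Param F))) (toPBW hq0 hd y) := by
  simp only [mulRightPBW, LinearMap.comp_apply, LinearMap.mulRight_apply, ofPBW_mono, toPBW_mul,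
    map_mul, map_pow, action_genA, action_genB, action_genC]

lemma mulRightPBW_toPBW_of_mem_center {z : Delta q} (hz : z ∈ Subalgebra.center F (Delta q))
    (y : Delta q) : mulRightPBW hq0 hd y (toPBW hq0 hd z) = action hq0 hd y (toPBW hq0 hd z) := by
  rw [mulRightPBW, LinearMap.comp_apply, LinearMap.comp_apply, ofPBW_toPBW,
    LinearMap.mulRight_apply, ← Subalgebra.mem_center_iff.1 hz y, toPBW_mul]

/-- The top coefficients of a central element vanish off the diagonal: comparing the leading terms
of `z A = A z` and `z B = B z` gives `q ^ (2 j) = q ^ (2 k)` and `q ^ (2 k) = q ^ (2 i)` when the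
coefficient at `AⁱBʲCᵏ` is nonzero. -/
lemma diagonal_of_mem_center (hq : ∀ n : ℕ, 0 < n → q ^ n ≠ 1) {z : Delta q}
    (hz : z ∈ Subalgebra.center F (Delta q)) {n : ℕ} (hn : toPBW hq0 hd z ∈ filD (Param F) (n + 1))
    {i j k : ℕ} (hijk : i + j + k = n) (h0 : toPBW hq0 hd z (i, j, k) ≠ 0) : i = k ∧ j = k := by
  have hinj : ∀ {a b : ℕ}, (C q ^ (2 * a) : Param F) = C q ^ (2 * b) → a = b := by
    intro a b h
    rw [← C_pow, ← C_pow] at h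
    replace h := C_injective _ _ h
    have h1 : ∀ {a b : ℕ}, q ^ (2 * a) = q ^ (2 * b) → ¬ a < b := by
      intro a b h hab
      refine hq (2 * b - 2 * a) (by lia) ?_
      rw [pow_sub₀ _ hq0 (by lia), h, mul_inv_cancel₀ (pow_ne_zero _ hq0)]
    exact le_antisymm (not_lt.1 (h1 h.symm)) (not_lt.1 (h1 h))
  have hA : toPBW hq0 hd (genA q) = mono 1 0 0 := by rw [toPBW_apply, action_genA, opA_mono]
  have hB : toPBW hq0 hd (genB q) = mono 0 1 0 := by
    rw [toPBW_apply, action_genB, AWDatum.opB_mono_zero]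
  have eA := mulRightPBW_toPBW_of_mem_center hq0 hd hz (genA q)
  have eB := mulRightPBW_toPBW_of_mem_center hq0 hd hz (genB q)
  have eA1 := coeff_of_leading (a := 1) (b := 0) (c := 0) rfl (fun i j k => by
    rw [mulRightPBW_mono hq0 hd, hA]; exact (datum hq0).mul_A_leading i j k) hn hijk
  have eA2 := coeff_of_leading (T := opA) (f := fun _ _ _ => (1 : Param F))
    (a := 1) (b := 0) (c := 0) rfl (fun i j k => by simp) hn hijk
  have eB1 := coeff_of_leading (a := 0) (b := 1) (c := 0) rfl (fun i j k => by
    rw [mulRightPBW_mono hq0 hd, hB]; exact (datum hq0).mul_B_leading i j k) hn hijk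
  have eB2 := coeff_of_leading (a := 0) (b := 1) (c := 0) rfl
    (fun i j k => (datum hq0).opB_leading i j k) hn hijk
  rw [eA, action_genA, eA2] at eA1
  rw [eB, action_genB, eB2] at eB1
  have hA3 := mul_right_cancel₀ h0 eA1
  have hB3 := mul_right_cancel₀ h0 eB1
  refine ⟨hinj hB3, hinj ?_⟩
  have := congrArg (· * (datum hq0).q ^ (2 * k)) hA3
  simp only [one_mul, mul_assoc, mul_comm ((datum hq0).qi ^ (2 * k)),
    AWDatum.q_pow_mul_qi_pow, mul_one] at this
  exact this.symm

/-- Evaluation of polynomials over `F[α, β, γ]` at the Casimir element. -/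
def casimirHom (q : F) : Polynomial (Param F) →ₐ[Param F] Delta q := Polynomial.aeval (Omega q)

include hd in
lemma casimirHom_mem_center (hq0 : q ≠ 0) (p : Polynomial (Param F)) :
    casimirHom q p ∈ Subalgebra.center F (Delta q) := by
  rw [casimirHom, Polynomial.aeval_eq_sum_range]
  exact sum_mem fun i _ => by
    rw [param_smul_def]
    exact mul_mem (paramHom q _).2 (pow_mem (Omega_mem_center hq0 hd) _)

include hd in
/-- Central elements are polynomials in `Ω` over `F[α, β, γ]`, by induction on the degree: a
multiple of a power of `Ω` removes the top part. -/
lemma exists_casimirHom_eq (hq0 : q ≠ 0) (hq : ∀ n : ℕ, 0 < n → q ^ n ≠ 1) (n : ℕ) :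
    ∀ z ∈ Subalgebra.center F (Delta q), toPBW hq0 hd z ∈ filD (Param F) n →
      ∃ p, casimirHom q p = z := by
  induction n with
  | zero =>
    intro z _ hz
    refine ⟨0, ?_⟩
    have : toPBW hq0 hd z = 0 := Finsupp.ext fun p => coeff_eq_zero_of_mem_filD hz (Nat.zero_le _)
    rw [map_zero, ← ofPBW_toPBW hq0 hd z, this, map_zero]
  | succ n ih =>
    intro z hzc hz
    by_cases hl : ∃ l, n = 3 * l
    · obtain ⟨l, rfl⟩ := hl
      -- `q ^ (l²)` is the leading coefficient of `Ωˡ`, so that `c Ωˡ` has the top part of `z`.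
      set c : Param F := C q⁻¹ ^ (l ^ 2) * toPBW hq0 hd z (l, l, l) with hc
      let p := Polynomial.monomial l c
      have hp : casimirHom q p = c • Omega q ^ l := by
        rw [casimirHom, Polynomial.aeval_monomial, Algebra.smul_def]
      obtain ⟨p', hp'⟩ := ih (z - casimirHom q p)
        (sub_mem hzc (casimirHom_mem_center hd hq0 p)) (by
          have hO := Submodule.smul_mem _ c (toPBW_Omega_pow hq0 hd l)
          have h1 : (C q ^ (l ^ 2) * C q⁻¹ ^ (l ^ 2) : Param F) = 1 :=
            (datum hq0).q_pow_mul_qi_pow _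
          have hcoef : c * C q ^ (l ^ 2) = toPBW hq0 hd z (l, l, l) := by
            rw [hc]; linear_combination (toPBW hq0 hd z (l, l, l)) * h1
          rw [smul_sub, smul_smul, hcoef] at hO
          have : toPBW hq0 hd (z - casimirHom q p) =
              (toPBW hq0 hd z - (toPBW hq0 hd z (l, l, l)) • mono l l l) -
              (c • toPBW hq0 hd (Omega q ^ l) - toPBW hq0 hd z (l, l, l) • mono l l l) := by
            rw [hp, map_sub, map_smul]; abel
          rw [this]
          refine sub_mem (mem_filD_of_coeff_eq_zero (sub_mem hz (Submodule.smul_mem _ _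
            (mono_mem_filD (by lia)))) fun i j k hijk => ?_) hO
          by_cases h0 : toPBW hq0 hd z (i, j, k) = 0
          · by_cases hil : (i, j, k) = (l, l, l)
            · rw [hil] at h0 ⊢
              simp [h0]
            · simp [h0, mono, Ne.symm hil]
          · obtain ⟨rfl, rfl⟩ := diagonal_of_mem_center hq0 hd hq hzc hz hijk h0
            obtain rfl : j = l := by lia
            simp [mono])
      exact ⟨p' + p, by rw [map_add, hp', sub_add_cancel]⟩
    · refine ih z hzc (mem_filD_of_coeff_eq_zero hz fun i j k hijk => ?_)
      by_contra h0
      obtain ⟨rfl, rfl⟩ := diagonal_of_mem_center hq0 hd hq hzc hz hijk h0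
      exact hl ⟨j, by lia⟩

include hd in
/-- Powers of `Ω` are independent over `F[α, β, γ]`: the coefficient at `AˡBˡCˡ`, with `l` the
degree, sees only the leading coefficient of a polynomial. -/
lemma casimirHom_injective (hq0 : q ≠ 0) : Function.Injective (casimirHom q) := by
  rw [injective_iff_map_eq_zero]
  intro p hp
  by_contra hne
  have hO (i : ℕ) := toPBW_Omega_pow hq0 hd i
  set l := p.natDegree with hl
  have h1 : toPBW hq0 hd (casimirHom q p) (l, l, l) = p.coeff l * C q ^ (l ^ 2) := by
    rw [casimirHom, Polynomial.aeval_eq_sum_range, map_sum, Finsupp.finsetSum_apply,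
      Finset.sum_range_succ, Finset.sum_eq_zero, zero_add, map_smul, Finsupp.smul_apply,
      smul_eq_mul]
    · have := coeff_eq_zero_of_mem_filD (hO l) (i := l) (j := l) (k := l) (by lia)
      rw [Finsupp.sub_apply, sub_eq_zero] at this
      rw [← hl, this]
      simp [mono]
    · intro i hi
      have hi' : i < l := Finset.mem_range.1 hi
      have := coeff_eq_zero_of_mem_filD (hO i) (i := l) (j := l) (k := l) (by lia)
      rw [Finsupp.sub_apply, sub_eq_zero] at this
      rw [map_smul, Finsupp.smul_apply, this]
      simp [mono, hi'.ne]
  rw [hp, map_zero, Finsupp.zero_apply, eq_comm, mul_eq_zero] at h1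
  rcases h1 with h1 | h1
  · exact hne (Polynomial.leadingCoeff_eq_zero.1 h1)
  · rw [← C_pow, C_eq_zero] at h1
    exact pow_ne_zero _ hq0 h1

/-- The homomorphism from the polynomial ring in four variables to the center of `Δ_q` that sends
the variables to `Ω`, `α`, `β`, `γ`. -/
def centerHom : MvPolynomial (Fin 4) F →ₐ[F] Subalgebra.center F (Delta q) :=
  aeval ![⟨Omega q, Omega_mem_center hq0 hd⟩, ⟨alpha q, alpha_mem_center q⟩,
    ⟨beta q, beta_mem_center q⟩, ⟨gamma q, gamma_mem_center q⟩]

lemma coe_centerHom (p : MvPolynomial (Fin 4) F) :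
    (centerHom hq0 hd p : Delta q) = casimirHom q (finSuccEquiv F 3 p) := by
  have : (Subalgebra.center F (Delta q)).val.comp (centerHom hq0 hd) =
      ((casimirHom q).restrictScalars F).comp (finSuccEquiv F 3 : _ →ₐ[F] _) := by
    refine MvPolynomial.algHom_ext fun i => ?_
    have h (i : Fin 3) : casimirHom q (finSuccEquiv F 3 (X i.succ)) = (X i : Param F) • 1 := by
      rw [finSuccEquiv_X_succ, casimirHom, Polynomial.aeval_C, Algebra.algebraMap_eq_smul_one]
    refine Fin.cases ?_ (fun i => ?_) i
    · simp [centerHom, casimirHom, finSuccEquiv_X_zero]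
    · refine Eq.trans ?_ (h i).symm
      fin_cases i
      · simpa [centerHom] using (X_smul_zero q 1).symm
      · simpa [centerHom] using (X_smul_one q 1).symm
      · simpa [centerHom] using (X_smul_two q 1).symm
  exact AlgHom.congr_fun this p

lemma centerHom_bijective (hq : ∀ n : ℕ, 0 < n → q ^ n ≠ 1) :
    Function.Bijective (centerHom hq0 hd) := by
  constructor
  · intro p p' h
    have := congrArg Subtype.val h
    rw [coe_centerHom, coe_centerHom] at this
    exact (finSuccEquiv F 3).injective (casimirHom_injective hd hq0 this)
  · rintro ⟨z, hz⟩
    obtain ⟨n, hn⟩ : ∃ n, toPBW hq0 hd z ∈ filD (Param F) n := by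
      refine ⟨(toPBW hq0 hd z).support.sup (fun p => p.1 + p.2.1 + p.2.2) + 1,
        (Finsupp.mem_supported _ _).2 fun p hp => ?_⟩
      exact Nat.lt_succ_of_le (Finset.le_sup (f := fun p : ℕ × ℕ × ℕ => p.1 + p.2.1 + p.2.2) hp)
    obtain ⟨p, hp⟩ := exists_casimirHom_eq hd hq0 hq n z hz hn
    refine ⟨(finSuccEquiv F 3).symm p, Subtype.ext ?_⟩
    rw [coe_centerHom, AlgEquiv.apply_symm_apply, hp]

end Center

/-- Exponent vectors in four variables as quadruples. -/
def exponentEquiv : (Fin 4 →₀ ℕ) ≃ ℕ × ℕ × ℕ × ℕ where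
  toFun f := (f 0, f 1, f 2, f 3)
  invFun p := Finsupp.equivFunOnFinite.symm ![p.1, p.2.1, p.2.2.1, p.2.2.2]
  left_inv f := by ext i; fin_cases i <;> rfl
  right_inv _ := rfl

lemma exponentEquiv_symm_apply (l r s t : ℕ) (i : Fin 4) :
    exponentEquiv.symm (l, r, s, t) i = ![l, r, s, t] i := rfl

end

end UAW

theorem theorem7p2 {F : Type*} [Field F] (q : F) (hq0 : q ≠ 0)
    (hq : ∀ n : ℕ, 0 < n → q ^ n ≠ 1) :
    (∃ b : Module.Basis (ℕ × ℕ × ℕ × ℕ) F (Subalgebra.center F (UAW.Delta q)),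
      ∀ l r s t : ℕ, (b (l, r, s, t) : UAW.Delta q)
        = UAW.Omega q ^ l * UAW.alpha q ^ r * UAW.beta q ^ s * UAW.gamma q ^ t) ∧
    Algebra.adjoin F {UAW.Omega q, UAW.alpha q, UAW.beta q, UAW.gamma q}
      = Subalgebra.center F (UAW.Delta q) ∧
    (∃ e : Subalgebra.center F (UAW.Delta q) ≃ₐ[F] MvPolynomial (Fin 4) F,
      (e.symm (MvPolynomial.X 0) : UAW.Delta q) = UAW.Omega q ∧
      (e.symm (MvPolynomial.X 1) : UAW.Delta q) = UAW.alpha q ∧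
      (e.symm (MvPolynomial.X 2) : UAW.Delta q) = UAW.beta q ∧
      (e.symm (MvPolynomial.X 3) : UAW.Delta q) = UAW.gamma q) := by
  have hd : q ^ 2 - q⁻¹ ^ 2 ≠ 0 := by
    intro h
    -- `q² = q⁻²` would give `q⁴ = 1`.
    refine hq 4 (by norm_num) ?_
    have h1 : q * q⁻¹ = 1 := mul_inv_cancel₀ hq0
    linear_combination q ^ 2 * h + (q * q⁻¹ + 1) * h1
  have hbij := UAW.centerHom_bijective hq0 hd hq
  let g := AlgEquiv.ofBijective (UAW.centerHom hq0 hd) hbij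
  refine ⟨⟨((MvPolynomial.basisMonomials (Fin 4) F).map g.toLinearEquiv).reindex
    UAW.exponentEquiv, fun l r s t => ?_⟩, le_antisymm ?_ fun z hz => ?_, g.symm, ?_, ?_, ?_, ?_⟩
  · simp [g, UAW.centerHom, UAW.exponentEquiv_symm_apply, MvPolynomial.aeval_monomial,
      Finsupp.prod_fintype, Fin.prod_univ_four]
  · rw [Algebra.adjoin_le_iff]
    rintro _ (rfl | rfl | rfl | rfl)
    · exact UAW.Omega_mem_center hq0 hd
    · exact UAW.alpha_mem_center q
    · exact UAW.beta_mem_center q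
    · exact UAW.gamma_mem_center q
  · obtain ⟨p, hp⟩ := hbij.2 ⟨z, hz⟩
    have hp' : (UAW.centerHom hq0 hd p : UAW.Delta q) = z := congrArg Subtype.val hp
    rw [← hp']
    clear hp hp'
    induction p using MvPolynomial.induction_on with
    | C r => rw [MvPolynomial.algHom_C]; exact Subalgebra.algebraMap_mem _ r
    | add p p' h h' => rw [map_add]; exact add_mem h h'
    | mul_X p i h =>
      rw [map_mul]
      refine mul_mem h (Algebra.subset_adjoin ?_)
      fin_cases i <;> simp [UAW.centerHom]
  all_goals simp [g, UAW.centerHom]
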